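/- Let $d\in\mathbb{N}$, let $\|\cdot\|$ be a norm on $\mathbb{R}^d$, let $F=(F_1,\dots,F_d):[0,\infty)\to\mathbb{R}^d$ be continuous, let $\zeta\in\mathbb{R}^d$, and let $A$ be a real $d\times d$ matrix all of whose (complex) eigenvalues have negative real parts. Let $x$ be the unique continuous solution of $$x'(t)=Ax(t)+F(t),\quad t\ge 0;\qquad x(0)=\zeta,$$ and let $y$ be the unique continuous solution of $$y'(t)=-y(t)+F(t),\quad t\ge 0;\qquad y(0)=0 .$$ Let $\gamma:[0,\infty)\to(0,\infty)$ be a subexponential weight, that is, $\gamma$ is continuous and $\lim_{t\to\infty}\gamma(t-\theta)/\gamma(t)=1$ for every $\theta>0$. Write $u^+=\max(u,0)$, let $\mathrm{Leb}$ be Lebesgue measure, and let limits superior take values in $[-\infty,\infty]$. Then the following are equivalent: (A) There exist $\Delta>0$ and $K>0$ such that $$\left\|\int_{(t-\theta)^+}^t F(s)\,ds\right\|\le K\gamma(t),\qquad \theta\in[0,\Delta],\ t\ge 0,$$ and there exist $i\in\{1,\dots,d\}$ and $\theta'>0$ such that $$\limsup_{t\to\infty}\frac{\left|\int_{t-\theta'}^t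 F_i(s)\,ds\right|}{\gamma(t)}>0.$$ (A$'$) For every $\Delta>0$ there is $K=K(\Delta)>0$ such that $$\left\|\int_{(t-\theta)^+}^t F(s)\,ds\right\|\le K\gamma(t),\qquad \theta\in[0,\Delta],\ t\ge 0,$$ and there exist $i\in\{1,\dots,d\}$ and $\theta'\in(0,\Delta]$ such that $$\limsup_{t\to\infty}\frac{\left|\int_{t-\theta'}^t F_i(s)\,ds\right|}{\gamma(t)}>0.$$ (A$''$) For every $\Delta>0$ there is $K=K(\Delta)>0$ such that $$\left\|\int_{(t-\theta)^+}^t F(s)\,ds\right\|\le K\gamma(t),\qquad \theta\in[0,\Delta],\ t\ge 0,$$ and there exists $i\in\{1,\dots,d\}$ such that $$\mathrm{Leb}\left(\theta\in[0,\Delta]:\ \limsup_{t\to\infty}\frac{\left|\int_{t-\theta}^t F_i(s)\,ds\right|}{\gamma(t)}=0\right)=0.$$ (B) $\displaystyle\limsup_{t\to\infty}\frac{\|y(t)\|}{\gamma(t)}\in(0,\infty)$. (C) $\displaystyle\limsup_{t\to\infty}\frac{\|x(t)\|}{\gamma(t)}\in(0,\infty)$. -/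

import Mathlib

open Filter Topology MeasureTheory Set

/-- A (finite lag) subexponential weight: a continuous positive function on `[0,∞)` with
`γ (t - θ) / γ t → 1` as `t → ∞`, for each `θ > 0`. Values at negative times are irrelevant. -/
structure IsSubexponential (γ : ℝ → ℝ) : Prop where
  continuousOn : ContinuousOn γ (Ici 0)
  pos : ∀ t, 0 ≤ t → 0 < γ t
  tendsto : ∀ θ, 0 < θ → Tendsto (fun t => γ (t - θ) / γ t) atTop (𝓝 1)

/-- All the (complex) eigenvalues of the real matrix `A` have negative real part. -/
def IsHurwitz {d : ℕ} (A : Matrix (Fin d) (Fin d) ℝ) : Prop :=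
  ∀ μ : ℂ, Module.End.HasEigenvalue (Matrix.toLin' (A.map (algebraMap ℝ ℂ))) μ → μ.re < 0

/-- `x` solves `x' (t) = A x(t) + F(t)` for `t ≥ 0`, with `x(0) = ζ` (the derivative at `0` is the
one-sided one; continuity of `x` on `[0,∞)` follows from differentiability). -/
structure IsLinearODESolution {d : ℕ} (A : Matrix (Fin d) (Fin d) ℝ) (F : ℝ → Fin d → ℝ)
    (ζ : Fin d → ℝ) (x : ℝ → Fin d → ℝ) : Prop where
  initial : x 0 = ζ
  hasDeriv : ∀ t, 0 ≤ t → HasDerivWithinAt x (A.mulVec (x t) + F t) (Ici 0) t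

/-- `‖∫_{(t-θ)^+}^t F(s) ds‖ ≤ K γ(t)` for all `θ ∈ [0,Δ]` and `t ≥ 0`, for the norm `N`. -/
def WindowBound {d : ℕ} (N : Seminorm ℝ (Fin d → ℝ)) (F : ℝ → Fin d → ℝ) (γ : ℝ → ℝ)
    (Δ K : ℝ) : Prop :=
  ∀ θ ∈ Icc 0 Δ, ∀ t, 0 ≤ t → N (∫ s in (max (t - θ) 0)..t, F s) ≤ K * γ t

/-- `limsup_{t → ∞} g(t) / γ(t)`, as an extended real number. -/
noncomputable def limsupRatio (g γ : ℝ → ℝ) : EReal :=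
  limsup (fun t : ℝ => ((g t / γ t : ℝ) : EReal)) atTop

/-- `limsup_{t → ∞} |∫_{t-θ}^t F_i(s) ds| / γ(t)`. -/
noncomputable def windowLimsup {d : ℕ} (F : ℝ → Fin d → ℝ) (γ : ℝ → ℝ) (i : Fin d) (θ : ℝ) :
    EReal :=
  limsupRatio (fun t => |∫ s in (t - θ)..t, F s i|) γ

/-! Let G be a primitive of F, so that window integrals are increments G(t) - G(t - θ). A limsup
lies in (0, ∞) exactly when the function is O(γ) but not o(γ), so it suffices to carry both O(γ) and
o(γ) between x, y and the windows.

Between x and y: x - y solves z' = Az + (A + I)y, from which F has vanished, and a Hurwitz system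
turns O(γ) forcing into O(γ) solutions and o(γ) into o(γ) (`IsHurwitz.isBigO`,
`IsHurwitz.isLittleO`). The roles of x and y can be exchanged.

From y to windows: (G - y)' = y, so a window integral is y(t) - y(t - θ) plus the integral of y over
the window (`exists_window_gain`). This needs γ comparable with its translates uniformly in bounded
lags, which Baire's theorem supplies.

From windows to y: the average E(t) of G(t) - G(t - θ) over θ in [0, Δ] satisfies E' = F - Δ⁻¹(G(t)
- G(t - Δ)). Hence y - E solves z' = -z + f with f built from windows only. For o(γ), dominated
convergence handles E.

Finally, the lags with o(γ) windows form a measurable subgroup of ℝ, which by Steinhaus is null or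
everything. This removes the dependence on θ' and Δ. -/

/-! ### Subexponential weights and a delay inequality -/

/-- A subexponential weight that is continuous and positive on the whole line. -/
structure IsGlobalWeight (γ : ℝ → ℝ) : Prop where
  continuous : Continuous γ
  pos : ∀ t, 0 < γ t
  tendsto : ∀ θ, Tendsto (fun t => γ (t - θ) / γ t) atTop (𝓝 1)

theorem IsSubexponential.isGlobalWeight {γ : ℝ → ℝ} (h : IsSubexponential γ) :
    IsGlobalWeight (fun t => γ (max t 0)) where
  continuous := h.continuousOn.comp_continuous (by fun_prop) (fun t => mem_Ici.2 (le_max_right _ _))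
  pos t := h.pos _ (le_max_right _ _)
  tendsto := by
    have key : ∀ θ, Tendsto (fun t => γ (t - θ) / γ t) atTop (𝓝 1) := by
      intro θ
      rcases lt_trichotomy θ 0 with hθ | rfl | hθ
      -- A negative lag: invert the ratio for `-θ` and translate time by `-θ`.
      · have h1 := ((h.tendsto (-θ) (by linarith)).inv₀ one_ne_zero).comp
          (tendsto_atTop_add_const_right atTop (-θ) tendsto_id)
        rw [inv_one] at h1
        refine h1.congr fun t => ?_
        simp [sub_eq_add_neg]
      · refine tendsto_const_nhds.congr' ?_
        filter_upwards [eventually_ge_atTop 0] with t ht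
        simp [(h.pos t ht).ne']
      · exact h.tendsto θ hθ
    intro θ
    refine (key θ).congr' ?_
    filter_upwards [eventually_ge_atTop 0, eventually_ge_atTop θ] with t h1 h2
    rw [max_eq_left h1, max_eq_left (by linarith)]

namespace IsGlobalWeight

variable {γ : ℝ → ℝ}

theorem eventually_shift_le (h : IsGlobalWeight γ) (θ : ℝ) {c : ℝ} (hc : 1 < c) :
    ∀ᶠ t in atTop, γ (t - θ) ≤ c * γ t := by
  filter_upwards [(h.tendsto θ).eventually_lt_const hc] with t ht
  exact ((div_lt_iff₀ (h.pos t)).1 ht).le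

theorem eventually_le_shift (h : IsGlobalWeight γ) (θ : ℝ) {c : ℝ} (hc : 1 < c) :
    ∀ᶠ t in atTop, γ t ≤ c * γ (t - θ) := by
  have := tendsto_atTop_add_const_right atTop (-θ) tendsto_id |>.eventually
    (h.eventually_shift_le (-θ) hc)
  filter_upwards [this] with t ht
  simpa [sub_eq_add_neg] using ht

theorem isBigO_shift (h : IsGlobalWeight γ) (θ : ℝ) :
    (fun t => γ (t - θ)) =O[atTop] γ := by
  refine Asymptotics.IsBigO.of_bound 2 ?_
  filter_upwards [h.eventually_shift_le θ one_lt_two] with t ht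
  simpa [abs_of_pos (h.pos _)] using ht

/-- On some interval of lags the weight is uniformly comparable with its translates. -/
theorem exists_uniform_short_lag (h : IsGlobalWeight γ) :
    ∃ δ > 0, ∃ T, ∀ t ≥ T, ∀ θ ∈ Icc 0 δ, γ (t - θ) ≤ 4 * γ t := by
  let E : ℕ → Set ℝ := fun n =>
    {θ | ∀ t : ℝ, (n : ℝ) ≤ t → γ (t - θ) ≤ 2 * γ t ∧ γ t ≤ 2 * γ (t - θ)}
  have hc := h.continuous
  have hE : ∀ n, IsClosed (E n) := by
    intro n
    simp only [E, ofPred_forall, ofPred_and]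
    refine isClosed_iInter fun t => isClosed_iInter fun _ => IsClosed.inter ?_ ?_
    · exact isClosed_le (by fun_prop) (by fun_prop)
    · exact isClosed_le (by fun_prop) (by fun_prop)
  have hU : ⋃ n, E n = univ := by
    refine eq_univ_of_forall fun θ => ?_
    obtain ⟨T, hT⟩ := eventually_atTop.1
      ((h.eventually_shift_le θ one_lt_two).and (h.eventually_le_shift θ one_lt_two))
    obtain ⟨n, hn⟩ := exists_nat_ge T
    exact mem_iUnion.2 ⟨n, fun t ht => hT t (hn.trans ht)⟩
  -- Baire: some `E n` contains a ball around a lag `a`. Passing from `t - θ` to `t` through `t + a`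
  -- uses the lags `a + θ` and `a`, each costing a factor 2.
  obtain ⟨n, a, ha⟩ := nonempty_interior_of_iUnion_of_closed hE hU
  obtain ⟨ε, hε, hball⟩ := Metric.mem_nhds_iff.1 (mem_interior_iff_mem_nhds.1 ha)
  refine ⟨ε / 2, by positivity, n - a, fun t ht θ hθ => ?_⟩
  have h1 := (hball (Metric.mem_ball_self hε) (t + a) (by linarith)).2
  have hmem : a + θ ∈ Metric.ball a ε := by
    rw [Metric.mem_ball, Real.dist_eq, add_sub_cancel_left, abs_of_nonneg hθ.1]
    linarith [hθ.2]
  have h2 := (hball hmem (t + a) (by linarith)).1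
  rw [add_sub_cancel_right] at h1
  rw [add_comm a, add_sub_add_right_eq_sub] at h2
  linarith

theorem exists_uniform_lag (h : IsGlobalWeight γ) (Δ : ℝ) :
    ∃ C > 0, ∃ T, ∀ t ≥ T, ∀ s ∈ Icc (t - Δ) t, γ s ≤ C * γ t := by
  obtain ⟨δ, hδ, T, hT⟩ := h.exists_uniform_short_lag
  have key : ∀ n : ℕ, ∃ T', ∀ t ≥ T', ∀ s ∈ Icc (t - n * δ) t, γ s ≤ 4 ^ n * γ t := by
    intro n
    induction n with
    | zero =>
      refine ⟨0, fun t _ s hs => ?_⟩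
      have : s = t := le_antisymm hs.2 (by simpa using hs.1)
      simp [this]
    | succ n ih =>
      obtain ⟨T', hT'⟩ := ih
      refine ⟨max T (T' + δ), fun t ht s hs => ?_⟩
      have ht1 := (le_max_left _ _).trans ht
      have ht2 := (le_max_right _ _).trans ht
      have hs1 := hs.1
      push_cast at hs1
      have h4 : (1 : ℝ) ≤ 4 ^ n := one_le_pow₀ (by norm_num)
      rcases le_total (t - δ) s with hs' | hs'
      · have := hT t ht1 (t - s) ⟨by linarith [hs.2], by linarith⟩
        rw [sub_sub_cancel] at this
        have h5 := mul_le_mul_of_nonneg_right h4 (h.pos t).le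
        rw [pow_succ]
        linarith
      · have h1 := hT t ht1 δ ⟨hδ.le, le_rfl⟩
        have h2 := hT' (t - δ) (by linarith) s ⟨by linarith, hs'⟩
        have h3 := mul_le_mul_of_nonneg_left h1 (zero_le_one.trans h4)
        rw [pow_succ]
        linarith
  obtain ⟨n, hn⟩ := exists_nat_ge (Δ / δ)
  obtain ⟨T', hT'⟩ := key n
  refine ⟨4 ^ n, by positivity, T', fun t ht s hs => hT' t ht s ⟨?_, hs.2⟩⟩
  rw [div_le_iff₀ hδ] at hn
  linarith [hs.1]

/-- A contractive delay inequality with a forcing term of order `γ` has solutions of order `γ`. -/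
theorem eventually_le_of_delay_inequality (h : IsGlobalWeight γ) {p : ℝ → ℝ} {r c : ℝ}
    (hr : 0 ≤ r) (hr1 : r < 1) (hc : 0 < c)
    (hp : ∃ T, ContinuousOn p (Ici T)) (hrec : ∀ᶠ t in atTop, p t ≤ r * p (t - 1) + c * γ t) :
    ∀ᶠ t in atTop, p t ≤ 4 / (1 - r) * c * γ t := by
  have hγ := h.pos
  -- The room between `r` and `ρ` absorbs the ratio γ(t - 1)/γ(t), which tends to 1.
  set ρ := (1 + r) / 2 with hρ
  have hρ1 : ρ < 1 := by rw [hρ]; linarith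
  have hρ0 : 0 < ρ := by rw [hρ]; linarith
  have hstep : ∀ᶠ t in atTop, r * γ (t - 1) ≤ ρ * γ t := by
    have h1 : Tendsto (fun t => r * (γ (t - 1) / γ t)) atTop (𝓝 (r * 1)) :=
      (h.tendsto 1).const_mul r
    filter_upwards [h1.eventually_lt_const (show r * 1 < ρ by rw [hρ]; linarith)] with t ht
    rw [← mul_div_assoc, div_lt_iff₀ (hγ t)] at ht
    exact ht.le
  obtain ⟨T₁, hT₁⟩ := hp
  obtain ⟨T₂, hT₂⟩ := eventually_atTop.1 (hrec.and hstep)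
  set T := max T₁ T₂
  obtain ⟨B, hB⟩ := (isCompact_Icc (a := T) (b := T + 1)).bddAbove_image (f := fun t => p t / γ t)
    (ContinuousOn.div (hT₁.mono fun t ht => (le_max_left _ _).trans ht.1)
      h.continuous.continuousOn fun t _ => (hγ t).ne')
  set B' := max B 0
  have hB' : 0 ≤ B' := le_max_right _ _
  -- Here `c / (1 - ρ)` is the fixed point of a ↦ ρa + c.
  have key : ∀ n : ℕ, ∀ t, T + n ≤ t → t ≤ T + n + 1 →
      p t ≤ (ρ ^ n * B' + c / (1 - ρ)) * γ t := by
    intro n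
    induction n with
    | zero =>
      intro t h1 h2
      have : p t / γ t ≤ B := hB ⟨t, ⟨by simpa using h1, by simpa using h2⟩, rfl⟩
      have h3 := (div_le_iff₀ (hγ t)).1 (this.trans (le_max_left B 0))
      have h4 : 0 ≤ c / (1 - ρ) * γ t := by
        have := hγ t
        have : 0 < 1 - ρ := by linarith
        positivity
      rw [pow_zero, one_mul, add_mul]
      linarith
    | succ n ih =>
      intro t h1 h2
      push_cast at h1 h2
      have hn : (0 : ℝ) ≤ n := n.cast_nonneg
      have htT : T₂ ≤ t := (le_max_right T₁ T₂).trans (by linarith)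
      have h3 := (hT₂ t htT).1
      have h4 := (hT₂ t htT).2
      have h5 := mul_le_mul_of_nonneg_left (ih (t - 1) (by linarith) (by linarith)) hr
      set a := ρ ^ n * B' + c / (1 - ρ)
      have ha : 0 ≤ a := by
        have : 0 < 1 - ρ := by linarith
        positivity
      have h6 := mul_le_mul_of_nonneg_left h4 ha
      have h7 : ρ ^ (n + 1) * B' + c / (1 - ρ) = a * ρ + c := by
        have : 1 - ρ ≠ 0 := by linarith
        simp only [a]
        field_simp
        ring
      rw [h7]
      linarith
  -- The initial data are eventually dominated by the fixed point; twice the latter is `4 / (1 - r)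
  -- * c`, a bound independent of `p`.
  have hlim : ∀ᶠ n : ℕ in atTop, ρ ^ n * B' < c / (1 - ρ) := by
    have h1 : Tendsto (fun n : ℕ => ρ ^ n * B') atTop (𝓝 (0 * B')) :=
      (tendsto_pow_atTop_nhds_zero_of_lt_one hρ0.le hρ1).mul_const B'
    rw [zero_mul] at h1
    exact h1.eventually_lt_const (div_pos hc (by linarith))
  have hfl : Tendsto (fun t : ℝ => ⌊t - T⌋₊) atTop atTop :=
    tendsto_nat_floor_atTop.comp (tendsto_atTop_add_const_right atTop (-T) tendsto_id)
  filter_upwards [hfl.eventually hlim, eventually_ge_atTop T] with t ht htT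
  have h1 := Nat.floor_le (sub_nonneg.2 htT)
  have h2 := (Nat.lt_floor_add_one (t - T)).le
  refine (key _ t (by linarith) (by linarith)).trans
    (mul_le_mul_of_nonneg_right ?_ (hγ t).le)
  have h3 : c / (1 - ρ) + c / (1 - ρ) = 4 / (1 - r) * c := by
    have : 1 - ρ = (1 - r) / 2 := by rw [hρ]; ring
    rw [this]
    have : 1 - r ≠ 0 := by linarith
    field_simp
    ring
  linarith

end IsGlobalWeight

/-! ### Linear systems with eigenvalues in the left half-plane -/

open Asymptotics Polynomial in
/-- Stability of a class `P` of functions passes from scalar equations to linear systems whose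
eigenvalues have negative real parts, by peeling off the factors of the minimal polynomial. -/
theorem stable_of_eigenvalues_re_neg {V : Type*} [NormedAddCommGroup V] [NormedSpace ℂ V]
    [NormedSpace ℝ V] [IsScalarTower ℝ ℂ V] [FiniteDimensional ℂ V] {P : (ℝ → V) → Prop}
    (hadd : ∀ f g, P f → P g → P (fun t => f t + g t))
    (hlin : ∀ (L : Module.End ℂ V) f, P f → P (fun t => L (f t)))
    (hode : ∀ a : ℂ, a.re < 0 → ∀ w g : ℝ → V,
      (∀ᶠ t in atTop, HasDerivAt w (a • w t + g t) t) → P g → P w)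
    (L : Module.End ℂ V) (hL : ∀ μ, L.HasEigenvalue μ → μ.re < 0) {v f : ℝ → V}
    (hv : ∀ᶠ t in atTop, HasDerivAt v (L (v t) + f t) t) (hf : P f) : P v := by
  have key : ∀ s : Multiset ℂ, (∀ a ∈ s, a.re < 0) →
      P (fun t => aeval L (s.map fun a => X - C a).prod (v t)) → P v := by
    intro s
    induction s using Multiset.induction with
    | empty => intro _ h; simpa using h
    | cons a s ih =>
      intro hs h
      refine ih (fun b hb => hs b (Multiset.mem_cons_of_mem hb)) ?_
      -- The function w = q(L)v solves w' = aw + (L - a)q(L)v + q(L)f, a scalar-coefficient equation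
      -- with forcing in `P`.
      set q := (s.map fun a => X - C a).prod
      refine hode a (hs a (Multiset.mem_cons_self a s)) _ _ ?_
        (hadd _ _ h (hlin (aeval L q) f hf))
      filter_upwards [hv] with t ht
      have h1 := ((LinearMap.toContinuousLinearMap (aeval L q)).restrictScalars
        ℝ).hasFDerivAt.comp_hasDerivAt t ht
      refine h1.congr_deriv ?_
      have h2 : aeval L (X * q) = aeval L (q * X) := by rw [mul_comm]
      have h3 := LinearMap.congr_fun h2 (v t)
      simp only [map_mul, aeval_X, Module.End.mul_apply] at h3
      simp only [Multiset.map_cons, Multiset.prod_cons, map_mul, map_sub, aeval_X, aeval_C, map_add,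
        Module.End.mul_apply, LinearMap.sub_apply, Module.algebraMap_end_apply, h3,
        ContinuousLinearMap.coe_restrictScalars', LinearMap.coe_toContinuousLinearMap', q]
      abel
  refine key (minpoly ℂ L).roots (fun a ha => hL a ?_) ?_
  · exact Module.End.hasEigenvalue_of_isRoot (isRoot_of_mem_roots ha)
  · have hm : ((minpoly ℂ L).roots.map fun a => X - C a).prod = minpoly ℂ L :=
      ((IsAlgClosed.splits _).eq_prod_roots_of_monic
        (minpoly.monic (Algebra.IsIntegral.isIntegral L))).symm
    -- The minimal polynomial annihilates `L`, so only `P 0` remains.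
    rw [hm]
    simpa using hlin 0 f hf

namespace IsGlobalWeight

open Asymptotics

variable {γ : ℝ → ℝ} {V : Type*} [NormedAddCommGroup V] [NormedSpace ℂ V] [NormedSpace ℝ V]
  [IsScalarTower ℝ ℂ V]

/-- Variation of constants over one unit of time gives ‖w(t)‖ ≤ e^{Re a}‖w(t - 1)‖ + Cεγ(t), a
contractive delay inequality. Since `M` is fixed before `w`, `g` and `ε`, one estimate serves both O
and o. -/
theorem exists_gain_of_re_neg (h : IsGlobalWeight γ) {a : ℂ} (ha : a.re < 0) :
    ∃ M > 0, ∀ (w g : ℝ → V), (∀ᶠ t in atTop, HasDerivAt w (a • w t + g t) t) →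
      ∀ ε > 0, (∀ᶠ t in atTop, ‖g t‖ ≤ ε * γ t) → ∀ᶠ t in atTop, ‖w t‖ ≤ M * ε * γ t := by
  obtain ⟨C, hC, T, hT⟩ := h.exists_uniform_lag 1
  have hr1 : Real.exp a.re < 1 := by simpa using ha
  refine ⟨4 / (1 - Real.exp a.re) * C, by have := sub_pos.2 hr1; positivity,
    fun w g hw ε hε hg => ?_⟩
  obtain ⟨T', hT'⟩ := eventually_atTop.1 (hw.and hg)
  rw [mul_assoc _ C ε]
  refine h.eventually_le_of_delay_inequality (r := Real.exp a.re) (Real.exp_pos _).le hr1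
    (by positivity) ⟨T', fun t ht => ?_⟩ ?_
  · exact (hT' t ht).1.continuousAt.norm.continuousWithinAt
  filter_upwards [eventually_ge_atTop T, eventually_ge_atTop (T' + 1)] with t h1 h2
  have hd : ∀ s ∈ Icc (t - 1) t, HasDerivWithinAt (fun s : ℝ => Complex.exp (a * (t - s : ℝ)) • w s)
      (Complex.exp (a * (t - s : ℝ)) • g s) (Icc (t - 1) t) s := by
    intro s hs
    have e1 : HasDerivAt (fun s : ℝ => Complex.exp (a * (t - s : ℝ)))
        (Complex.exp (a * (t - s : ℝ)) * (a * (-1 : ℝ))) s :=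
      ((((hasDerivAt_id s).const_sub t).ofReal_comp).const_mul a).cexp
    refine (e1.smul (hT' s (by linarith [hs.1])).1).hasDerivWithinAt.congr_deriv ?_
    rw [smul_add, smul_smul]
    simp only [Complex.ofReal_neg, Complex.ofReal_one, mul_neg, mul_one, neg_smul]
    abel
  have hb : ∀ s ∈ Ico (t - 1) t, ‖Complex.exp (a * (t - s : ℝ)) • g s‖ ≤ C * ε * γ t := by
    intro s hs
    have b1 : ‖Complex.exp (a * (t - s : ℝ))‖ ≤ 1 := by
      rw [Complex.norm_exp, Complex.re_mul_ofReal, Real.exp_le_one_iff]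
      nlinarith [hs.2]
    have b2 := (hT' s (by linarith [hs.1])).2
    have b3 := mul_le_mul_of_nonneg_left (hT t h1 s ⟨hs.1, hs.2.le⟩) hε.le
    rw [norm_smul]
    have b4 := mul_le_mul_of_nonneg_right b1 (norm_nonneg (g s))
    linarith
  have hmv := norm_image_sub_le_of_norm_deriv_le_segment' hd hb t ⟨by linarith, le_rfl⟩
  have e2 : ‖Complex.exp a • w (t - 1)‖ = Real.exp a.re * ‖w (t - 1)‖ := by
    rw [norm_smul, Complex.norm_exp]
  simp only [sub_self, Complex.ofReal_zero, mul_zero, Complex.exp_zero, one_smul, sub_sub_cancel,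
    Complex.ofReal_one, mul_one] at hmv
  have := norm_sub_norm_le (w t) (Complex.exp a • w (t - 1))
  linarith

theorem isBigO_of_re_neg (h : IsGlobalWeight γ) {a : ℂ} (ha : a.re < 0) {w g : ℝ → V}
    (hw : ∀ᶠ t in atTop, HasDerivAt w (a • w t + g t) t) (hg : g =O[atTop] γ) :
    w =O[atTop] γ := by
  obtain ⟨M, -, hM⟩ := h.exists_gain_of_re_neg (V := V) ha
  obtain ⟨c, hc, hgc⟩ := hg.exists_pos
  refine IsBigO.of_bound (M * c) ?_
  have := hM w g hw c hc (by
    filter_upwards [hgc.bound] with t ht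
    simpa [abs_of_pos (h.pos t)] using ht)
  filter_upwards [this] with t ht
  simpa [abs_of_pos (h.pos t)] using ht

theorem isLittleO_of_re_neg (h : IsGlobalWeight γ) {a : ℂ} (ha : a.re < 0) {w g : ℝ → V}
    (hw : ∀ᶠ t in atTop, HasDerivAt w (a • w t + g t) t) (hg : g =o[atTop] γ) :
    w =o[atTop] γ := by
  obtain ⟨M, hM0, hM⟩ := h.exists_gain_of_re_neg (V := V) ha
  refine IsLittleO.of_bound fun c hc => ?_
  have := hM w g hw (c / M) (by positivity) (by
    filter_upwards [hg.bound (show 0 < c / M by positivity)] with t ht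
    simpa [abs_of_pos (h.pos t)] using ht)
  filter_upwards [this] with t ht
  rw [mul_div_cancel₀ _ hM0.ne'] at ht
  simpa [abs_of_pos (h.pos t)] using ht

end IsGlobalWeight

/-! ### Transfer from complex to real systems -/

section Complexification

variable {d : ℕ}

/-- The coordinatewise inclusion of `ℝ^d` in `ℂ^d`. -/
def complexify (v : Fin d → ℝ) : Fin d → ℂ := fun i => (v i : ℂ)

theorem norm_complexify (v : Fin d → ℝ) : ‖complexify v‖ = ‖v‖ := by
  simp [complexify, Pi.norm_def]

theorem hasDerivAt_complexify {A : Matrix (Fin d) (Fin d) ℝ} {v f : ℝ → Fin d → ℝ} {t : ℝ}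
    (hv : HasDerivAt v (A.mulVec (v t) + f t) t) :
    HasDerivAt (fun s => complexify (v s))
      (Matrix.toLin' (A.map (algebraMap ℝ ℂ)) (complexify (v t)) + complexify (f t)) t := by
  rw [hasDerivAt_pi] at hv ⊢
  intro i
  refine (hv i).ofReal_comp.congr_deriv ?_
  simp [complexify, Matrix.mulVec, dotProduct]

open Asymptotics

theorem isBigO_complexify {γ : ℝ → ℝ} {v : ℝ → Fin d → ℝ} :
    (fun t => complexify (v t)) =O[atTop] γ ↔ v =O[atTop] γ := by
  rw [← isBigO_norm_left, ← isBigO_norm_left (f' := v)]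
  simp only [norm_complexify]

theorem isLittleO_complexify {γ : ℝ → ℝ} {v : ℝ → Fin d → ℝ} :
    (fun t => complexify (v t)) =o[atTop] γ ↔ v =o[atTop] γ := by
  rw [← isLittleO_norm_left, ← isLittleO_norm_left (f' := v)]
  simp only [norm_complexify]

theorem IsHurwitz.isBigO {A : Matrix (Fin d) (Fin d) ℝ} (hA : IsHurwitz A) {γ : ℝ → ℝ}
    (h : IsGlobalWeight γ) {v f : ℝ → Fin d → ℝ}
    (hv : ∀ᶠ t in atTop, HasDerivAt v (A.mulVec (v t) + f t) t) (hf : f =O[atTop] γ) :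
    v =O[atTop] γ := by
  rw [← isBigO_complexify] at hf ⊢
  exact stable_of_eigenvalues_re_neg (P := fun g : ℝ → Fin d → ℂ => g =O[atTop] γ)
    (fun _ _ => IsBigO.add)
    (fun L f hf => ((LinearMap.toContinuousLinearMap L).isBigO_comp f atTop).trans hf)
    (fun a ha w g hw hg => h.isBigO_of_re_neg ha hw hg) _ hA
    (hv.mono fun t ht => hasDerivAt_complexify ht) hf

theorem IsHurwitz.isLittleO {A : Matrix (Fin d) (Fin d) ℝ} (hA : IsHurwitz A) {γ : ℝ → ℝ}
    (h : IsGlobalWeight γ) {v f : ℝ → Fin d → ℝ}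
    (hv : ∀ᶠ t in atTop, HasDerivAt v (A.mulVec (v t) + f t) t) (hf : f =o[atTop] γ) :
    v =o[atTop] γ := by
  rw [← isLittleO_complexify] at hf ⊢
  exact stable_of_eigenvalues_re_neg (P := fun g : ℝ → Fin d → ℂ => g =o[atTop] γ)
    (fun _ _ => IsLittleO.add)
    (fun L f hf => ((LinearMap.toContinuousLinearMap L).isBigO_comp f atTop).trans_isLittleO hf)
    (fun a ha w g hw hg => h.isLittleO_of_re_neg ha hw hg) _ hA
    (hv.mono fun t ht => hasDerivAt_complexify ht) hf

theorem isHurwitz_neg_one : IsHurwitz (-1 : Matrix (Fin d) (Fin d) ℝ) := by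
  intro μ hμ
  obtain ⟨v, hv⟩ := hμ.exists_hasEigenvector
  have h1 := hv.apply_eq_smul
  have h2 : (-1 : Matrix (Fin d) (Fin d) ℝ).map (algebraMap ℝ ℂ) = -1 := by
    ext i j
    by_cases hij : i = j <;> simp [hij]
  rw [h2] at h1
  have h3 : (μ + 1) • v = 0 := by
    rw [add_smul, ← h1]
    simp
  rcases smul_eq_zero.1 h3 with h4 | h4
  · rw [eq_neg_of_add_eq_zero_left h4]
    simp
  · exact absurd h4 hv.2

end Complexification

/-! ### Windows controlled by y -/

namespace IsGlobalWeight

open Asymptotics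

variable {γ : ℝ → ℝ} {d : ℕ}

/-- Window integrals of `F` are controlled, uniformly over bounded window lengths, by the size
of a solution of `y' = -y + F`. -/
theorem exists_window_gain {V : Type*} [NormedAddCommGroup V] [NormedSpace ℝ V]
    (h : IsGlobalWeight γ) {F G y : ℝ → V} (hG : ∀ t, HasDerivAt G (F t) t)
    (hy : ∀ᶠ t in atTop, HasDerivAt y (-y t + F t) t) (Δ : ℝ) :
    ∃ M > 0, ∀ ε > 0, (∀ᶠ t in atTop, ‖y t‖ ≤ ε * γ t) →
      ∀ᶠ t in atTop, ∀ θ ∈ Icc 0 Δ, ‖G t - G (t - θ)‖ ≤ M * ε * γ t := by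
  obtain ⟨C, hC, T, hT⟩ := h.exists_uniform_lag Δ
  refine ⟨C * |Δ| + 1 + C, by positivity, fun ε hε hyε => ?_⟩
  obtain ⟨T', hT'⟩ := eventually_atTop.1 (hy.and hyε)
  filter_upwards [eventually_ge_atTop T, eventually_ge_atTop (T' + |Δ|)] with t h1 h2 θ hθ
  have hΔ := le_abs_self Δ
  have hlow : T' ≤ t - θ := by linarith [hθ.2]
  have hbd : ∀ s ∈ Icc (t - θ) t, ‖y s‖ ≤ C * ε * γ t := by
    intro s hs
    have b1 := (hT' s (by linarith [hs.1])).2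
    have b2 := mul_le_mul_of_nonneg_left (hT t h1 s ⟨by linarith [hs.1, hθ.2], hs.2⟩) hε.le
    linarith
  -- Since (G - y)' = y, the mean value inequality applies without any bound on F.
  have hmv := norm_image_sub_le_of_norm_deriv_le_segment' (f := fun s => G s - y s) (f' := y)
    (a := t - θ) (b := t) (C := C * ε * γ t)
    (fun s hs => (((hG s).sub (hT' s (by linarith [hs.1])).1).congr_deriv
      (by abel)).hasDerivWithinAt)
    (fun s hs => hbd s ⟨hs.1, hs.2.le⟩) t ⟨by linarith [hθ.1], le_rfl⟩
  have b1 := (hT' t (by linarith [hθ.1])).2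
  have b2 := hbd (t - θ) ⟨le_rfl, by linarith [hθ.1]⟩
  have b3 : C * ε * γ t * (t - (t - θ)) ≤ C * ε * γ t * |Δ| := by
    have := h.pos t
    refine mul_le_mul_of_nonneg_left (by linarith [hθ.2]) (by positivity)
  have b4 : G t - G (t - θ) = (G t - y t - (G (t - θ) - y (t - θ))) + y t - y (t - θ) := by abel
  calc ‖G t - G (t - θ)‖
      ≤ ‖G t - y t - (G (t - θ) - y (t - θ))‖ + ‖y t‖ + ‖y (t - θ)‖ := by
        rw [b4]
        exact (norm_sub_le _ _).trans (by gcongr; exact norm_add_le _ _)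
    _ ≤ (C * |Δ| + 1 + C) * ε * γ t := by linarith

theorem window_isLittleO {V : Type*} [NormedAddCommGroup V] [NormedSpace ℝ V]
    (h : IsGlobalWeight γ) {F G y : ℝ → V} (hG : ∀ t, HasDerivAt G (F t) t)
    (hy : ∀ᶠ t in atTop, HasDerivAt y (-y t + F t) t) (ho : y =o[atTop] γ) {θ : ℝ} (hθ : 0 ≤ θ) :
    (fun t => G t - G (t - θ)) =o[atTop] γ := by
  obtain ⟨M, hM, hgain⟩ := h.exists_window_gain hG hy θ
  refine IsLittleO.of_bound fun c hc => ?_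
  have := hgain (c / M) (by positivity) (by
    filter_upwards [ho.bound (show 0 < c / M by positivity)] with t ht
    simpa [abs_of_pos (h.pos t)] using ht)
  filter_upwards [this] with t ht
  have := ht θ ⟨hθ, le_rfl⟩
  rw [mul_div_cancel₀ _ hM.ne'] at this
  simpa [abs_of_pos (h.pos t)] using this

end IsGlobalWeight

/-! ### y controlled by windows -/

/-- The average over `θ ∈ [0,Δ]` of the increments `G t - G (t - θ)`. -/
noncomputable def averageIncrement {d : ℕ} (G : ℝ → Fin d → ℝ) (Δ t : ℝ) : Fin d → ℝ :=
  Δ⁻¹ • ∫ θ in (0 : ℝ)..Δ, (G t - G (t - θ))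

section Average

open Asymptotics

variable {γ : ℝ → ℝ} {d : ℕ} {F G : ℝ → Fin d → ℝ} {Δ : ℝ}

/-- The average is G(t) minus the mean of G over [t - Δ, t]. Its derivative reproduces F up to one
window, so subtracting it from y removes F, whose pointwise size is uncontrolled. -/
theorem hasDerivAt_averageIncrement (hG : ∀ t, HasDerivAt G (F t) t) (hΔ : 0 < Δ) (t : ℝ) :
    HasDerivAt (averageIncrement G Δ) (F t - Δ⁻¹ • (G t - G (t - Δ))) t := by
  have hc : Continuous G := continuous_iff_continuousAt.2 fun t => (hG t).continuousAt
  have hI : ∀ u, HasDerivAt (fun u => ∫ s in (0 : ℝ)..u, G s) (G u) u := fun u =>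
    intervalIntegral.integral_hasDerivAt_right (hc.intervalIntegrable _ _)
      hc.aestronglyMeasurable.stronglyMeasurableAtFilter hc.continuousAt
  have heq : averageIncrement G Δ = fun t =>
      G t - Δ⁻¹ • ((∫ s in (0 : ℝ)..t, G s) - ∫ s in (0 : ℝ)..(t - Δ), G s) := by
    funext t
    have hint : IntervalIntegrable (fun θ => G (t - θ)) volume 0 Δ :=
      (hc.comp (continuous_const.sub continuous_id)).intervalIntegrable _ _
    rw [averageIncrement, intervalIntegral.integral_sub (by simp) hint, intervalIntegral.integral_const,
      intervalIntegral.integral_comp_sub_left (fun s => G s), smul_sub, sub_zero, smul_smul,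
      inv_mul_cancel₀ hΔ.ne', one_smul, sub_zero,
      intervalIntegral.integral_interval_sub_left (hc.intervalIntegrable _ _)
        (hc.intervalIntegrable _ _)]
  rw [heq]
  exact (hG t).fun_sub (((hI t).fun_sub ((hI (t - Δ)).comp_sub_const t Δ)).fun_const_smul Δ⁻¹)

theorem norm_averageIncrement_le (hΔ : 0 < Δ) (t : ℝ) :
    ‖averageIncrement G Δ t‖ ≤ Δ⁻¹ * ∫ θ in (0 : ℝ)..Δ, ‖G t - G (t - θ)‖ := by
  rw [averageIncrement, norm_smul, Real.norm_of_nonneg (by positivity)]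
  gcongr
  exact intervalIntegral.norm_integral_le_integral_norm hΔ.le

theorem averageIncrement_isBigO (hγ : IsGlobalWeight γ) (hΔ : 0 < Δ) {K : ℝ}
    (hK : ∀ᶠ t in atTop, ∀ θ ∈ Icc 0 Δ, ‖G t - G (t - θ)‖ ≤ K * γ t) :
    averageIncrement G Δ =O[atTop] γ := by
  refine IsBigO.of_bound K ?_
  filter_upwards [hK] with t ht
  rw [averageIncrement, norm_smul, Real.norm_of_nonneg (inv_nonneg.2 hΔ.le),
    Real.norm_of_nonneg (hγ.pos t).le, inv_mul_le_iff₀ hΔ]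
  have := intervalIntegral.norm_integral_le_of_norm_le_const (a := 0) (b := Δ)
    (f := fun θ => G t - G (t - θ)) (C := K * γ t) fun θ hθ => by
      rw [uIoc_of_le hΔ.le] at hθ
      exact ht θ ⟨hθ.1.le, hθ.2⟩
  rw [sub_zero, abs_of_pos hΔ] at this
  linarith

/-- Decay is assumed only lag by lag; the uniform bound `K` is the dominating function that permits
integration in θ. -/
theorem averageIncrement_isLittleO (hγ : IsGlobalWeight γ) (hc : Continuous G) (hΔ : 0 < Δ) {K : ℝ}
    (hK : ∀ᶠ t in atTop, ∀ θ ∈ Icc 0 Δ, ‖G t - G (t - θ)‖ ≤ K * γ t)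
    (ho : ∀ θ ∈ Ioc 0 Δ, (fun t => G t - G (t - θ)) =o[atTop] γ) :
    averageIncrement G Δ =o[atTop] γ := by
  have hlim : Tendsto (fun t => ∫ θ in (0 : ℝ)..Δ, ‖G t - G (t - θ)‖ / γ t) atTop
      (𝓝 (∫ _ in (0 : ℝ)..Δ, (0 : ℝ))) := by
    refine intervalIntegral.tendsto_integral_filter_of_dominated_convergence (fun _ => K) ?_ ?_
      (by simp) ?_
    · refine Eventually.of_forall fun t => Continuous.aestronglyMeasurable ?_
      exact ((continuous_const.sub (hc.comp (by fun_prop))).norm).div_const _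
    · filter_upwards [hK] with t ht
      refine ae_of_all _ fun θ hθ => ?_
      rw [uIoc_of_le hΔ.le] at hθ
      rw [norm_div, norm_norm, Real.norm_of_nonneg (hγ.pos t).le, div_le_iff₀ (hγ.pos t)]
      exact ht θ ⟨hθ.1.le, hθ.2⟩
    · refine ae_of_all _ fun θ hθ => ?_
      rw [uIoc_of_le hΔ.le] at hθ
      exact (ho θ hθ).norm_left.tendsto_div_nhds_zero
  have h1 : (fun t => ∫ θ in (0 : ℝ)..Δ, ‖G t - G (t - θ)‖) =o[atTop] γ := by
    refine (isLittleO_iff_tendsto fun t ht => absurd ht (hγ.pos t).ne').2 ?_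
    simpa [intervalIntegral.integral_div] using hlim
  refine IsBigO.trans_isLittleO (IsBigO.of_bound Δ⁻¹ (Eventually.of_forall fun t => ?_)) h1
  rw [Real.norm_of_nonneg
    (intervalIntegral.integral_nonneg hΔ.le fun _ _ => norm_nonneg (G t - G (t - _)))]
  exact norm_averageIncrement_le hΔ t

theorem hasDerivAt_sub_averageIncrement {y : ℝ → Fin d → ℝ} (hG : ∀ t, HasDerivAt G (F t) t)
    (hΔ : 0 < Δ) {t : ℝ} (hy : HasDerivAt y (-y t + F t) t) :
    HasDerivAt (fun t => y t - averageIncrement G Δ t)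
      ((-1 : Matrix (Fin d) (Fin d) ℝ).mulVec (y t - averageIncrement G Δ t) +
        (Δ⁻¹ • (G t - G (t - Δ)) - averageIncrement G Δ t)) t := by
  refine (hy.sub (hasDerivAt_averageIncrement hG hΔ t)).congr_deriv ?_
  rw [Matrix.neg_mulVec, Matrix.one_mulVec]
  abel

theorem isBigO_of_window_bound (hγ : IsGlobalWeight γ) (hG : ∀ t, HasDerivAt G (F t) t)
    {y : ℝ → Fin d → ℝ} (hy : ∀ᶠ t in atTop, HasDerivAt y (-y t + F t) t) (hΔ : 0 < Δ) {K : ℝ}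
    (hK : ∀ᶠ t in atTop, ∀ θ ∈ Icc 0 Δ, ‖G t - G (t - θ)‖ ≤ K * γ t) :
    y =O[atTop] γ := by
  have hE := averageIncrement_isBigO hγ hΔ hK
  have hW : (fun t => G t - G (t - Δ)) =O[atTop] γ := by
    refine IsBigO.of_bound K ?_
    filter_upwards [hK] with t ht
    rw [Real.norm_of_nonneg (hγ.pos t).le]
    exact ht Δ ⟨hΔ.le, le_rfl⟩
  have := isHurwitz_neg_one.isBigO hγ (hy.mono fun t ht => hasDerivAt_sub_averageIncrement hG hΔ ht)
    ((hW.const_smul_left Δ⁻¹).sub hE)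
  simpa using this.add hE

theorem isLittleO_of_window_isLittleO (hγ : IsGlobalWeight γ) (hG : ∀ t, HasDerivAt G (F t) t)
    {y : ℝ → Fin d → ℝ} (hy : ∀ᶠ t in atTop, HasDerivAt y (-y t + F t) t) (hΔ : 0 < Δ) {K : ℝ}
    (hK : ∀ᶠ t in atTop, ∀ θ ∈ Icc 0 Δ, ‖G t - G (t - θ)‖ ≤ K * γ t)
    (ho : ∀ θ ∈ Ioc 0 Δ, (fun t => G t - G (t - θ)) =o[atTop] γ) :
    y =o[atTop] γ := by
  have hc : Continuous G := continuous_iff_continuousAt.2 fun t => (hG t).continuousAt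
  have hE := averageIncrement_isLittleO hγ hc hΔ hK ho
  have := isHurwitz_neg_one.isLittleO hγ
    (hy.mono fun t ht => hasDerivAt_sub_averageIncrement hG hΔ ht)
    (((ho Δ ⟨hΔ, le_rfl⟩).const_smul_left Δ⁻¹).sub hE)
  simpa using this.add hE

end Average

/-! ### The subgroup of negligible lags -/

theorem AddSubgroup.eq_top_of_mem_nhds_zero {S : AddSubgroup ℝ} (hS : (S : Set ℝ) ∈ 𝓝 0) :
    S = ⊤ := by
  refine (AddSubgroup.eq_top_iff' S).2 fun x => ?_
  have h1 : Tendsto (fun n : ℕ => x / n) atTop (𝓝 0) := tendsto_const_div_atTop_nhds_zero_nat x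
  obtain ⟨n, hn, hn0⟩ := ((h1.eventually hS).and (eventually_gt_atTop 0)).exists
  have h2 := S.nsmul_mem hn n
  rwa [nsmul_eq_mul, mul_div_cancel₀ _ (by positivity)] at h2

section Lags

open Asymptotics

variable {γ : ℝ → ℝ}

/-- The lags `θ` for which `G t - G (t - θ) = o(γ t)`. -/
def negligibleLags (hγ : IsGlobalWeight γ) (G : ℝ → ℝ) : AddSubgroup ℝ where
  carrier := {θ | (fun t => G t - G (t - θ)) =o[atTop] γ}
  zero_mem' := by simp
  add_mem' := by
    intro a b ha hb
    -- Increments telescope, and a translate of an o(γ) function is o(γ) because γ(t - a) = O(γ(t)).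
    have h1 : (fun t => G (t - a) - G (t - a - b)) =o[atTop] γ :=
      (hb.comp_tendsto (tendsto_atTop_add_const_right atTop (-a) tendsto_id)).trans_isBigO
        (hγ.isBigO_shift a)
    refine (IsLittleO.add ha h1).congr_left fun t => ?_
    rw [sub_sub t a b]
    ring
  neg_mem' := by
    intro a ha
    have h1 : (fun t => G (t - -a) - G (t - -a - a)) =o[atTop] γ :=
      (ha.comp_tendsto (tendsto_atTop_add_const_right atTop (-(-a)) tendsto_id)).trans_isBigO
        (hγ.isBigO_shift (-a))
    refine h1.neg_left.congr_left fun t => ?_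
    rw [show t - -a - a = t by ring]
    ring

theorem mem_negligibleLags {hγ : IsGlobalWeight γ} {G : ℝ → ℝ} {θ : ℝ} :
    θ ∈ negligibleLags hγ G ↔ (fun t => G t - G (t - θ)) =o[atTop] γ := Iff.rfl

/-- Tolerances and starting times may be taken countable, and for each pair the condition on θ is
closed by continuity. -/
theorem measurableSet_negligibleLags (hγ : IsGlobalWeight γ) {G : ℝ → ℝ} (hG : Continuous G) :
    MeasurableSet (negligibleLags hγ G : Set ℝ) := by
  have heq : (negligibleLags hγ G : Set ℝ) =
      ⋂ k : ℕ, ⋃ n : ℕ, {θ | ∀ t : ℝ, (n : ℝ) ≤ t → |G t - G (t - θ)| ≤ 1 / (k + 1 : ℝ) * γ t} := by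
    ext θ
    simp only [SetLike.mem_coe, mem_negligibleLags, mem_iInter, mem_iUnion]
    constructor
    · intro h k
      obtain ⟨T, hT⟩ := eventually_atTop.1 (h.bound (show (0 : ℝ) < 1 / (k + 1 : ℝ) by positivity))
      obtain ⟨n, hn⟩ := exists_nat_ge T
      refine ⟨n, fun t ht => ?_⟩
      simpa [abs_of_pos (hγ.pos t)] using hT t (hn.trans ht)
    · intro h
      refine IsLittleO.of_bound fun c hc => ?_
      obtain ⟨k, hk⟩ := exists_nat_one_div_lt hc
      obtain ⟨n, hn⟩ := h k
      filter_upwards [eventually_ge_atTop (n : ℝ)] with t ht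
      rw [Real.norm_eq_abs, Real.norm_of_nonneg (hγ.pos t).le]
      exact (hn t ht).trans (mul_le_mul_of_nonneg_right hk.le (hγ.pos t).le)
  rw [heq]
  refine MeasurableSet.iInter fun k => MeasurableSet.iUnion fun n => IsClosed.measurableSet ?_
  simp only [ofPred_forall]
  exact isClosed_iInter fun t => isClosed_iInter fun _ =>
    isClosed_le (by fun_prop) (by fun_prop)

/-- Steinhaus: the differences of a measurable set of positive measure fill a neighbourhood of 0,
and a subgroup containing one is all of ℝ. -/
theorem negligibleLags_eq_top_of_volume_pos (hγ : IsGlobalWeight γ) {G : ℝ → ℝ}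
    (hG : Continuous G) (h : 0 < volume (negligibleLags hγ G : Set ℝ)) :
    negligibleLags hγ G = ⊤ := by
  refine AddSubgroup.eq_top_of_mem_nhds_zero (mem_of_superset
    (Measure.sub_mem_nhds_zero_of_addHaar_pos volume _ (measurableSet_negligibleLags hγ hG) h) ?_)
  rintro _ ⟨a, ha, b, hb, rfl⟩
  exact (negligibleLags hγ G).sub_mem ha hb

end Lags

/-! ### Limsups as O and o conditions -/

section LimsupRatio

open Asymptotics

variable {γ g : ℝ → ℝ}

theorem limsupRatio_nonneg (hγ : IsGlobalWeight γ) (hg : ∀ t, 0 ≤ g t) :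
    0 ≤ limsupRatio g γ := by
  refine le_limsup_of_frequently_le (Eventually.of_forall fun t => ?_).frequently
  exact EReal.coe_nonneg.2 (div_nonneg (hg t) (hγ.pos t).le)

theorem limsupRatio_lt_top_iff (hγ : IsGlobalWeight γ) (hg : ∀ t, 0 ≤ g t) :
    limsupRatio g γ < ⊤ ↔ g =O[atTop] γ := by
  constructor
  · intro h
    obtain ⟨c, hc, -⟩ := EReal.lt_iff_exists_real_btwn.1 h
    refine IsBigO.of_bound c ?_
    filter_upwards [eventually_lt_of_limsup_lt hc] with t ht
    rw [EReal.coe_lt_coe_iff, div_lt_iff₀ (hγ.pos t)] at ht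
    rw [Real.norm_of_nonneg (hg t), Real.norm_of_nonneg (hγ.pos t).le]
    exact ht.le
  · intro h
    obtain ⟨c, hc⟩ := h.bound
    refine lt_of_le_of_lt (limsup_le_of_le (a := (c : EReal)) (by isBoundedDefault) ?_)
      (EReal.coe_lt_top c)
    filter_upwards [hc] with t ht
    rw [Real.norm_of_nonneg (hg t), Real.norm_of_nonneg (hγ.pos t).le] at ht
    exact EReal.coe_le_coe_iff.2 ((div_le_iff₀ (hγ.pos t)).2 ht)

theorem limsupRatio_eq_zero_iff (hγ : IsGlobalWeight γ) (hg : ∀ t, 0 ≤ g t) :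
    limsupRatio g γ = 0 ↔ g =o[atTop] γ := by
  constructor
  · intro h
    refine IsLittleO.of_bound fun c hc => ?_
    have hlt : limsupRatio g γ < (c : EReal) := h ▸ EReal.coe_pos.2 hc
    filter_upwards [eventually_lt_of_limsup_lt hlt] with t ht
    rw [EReal.coe_lt_coe_iff, div_lt_iff₀ (hγ.pos t)] at ht
    rw [Real.norm_of_nonneg (hg t), Real.norm_of_nonneg (hγ.pos t).le]
    exact ht.le
  · intro h
    have h1 := (continuous_coe_real_ereal.tendsto 0).comp h.tendsto_div_nhds_zero
    exact h1.limsup_eq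

theorem limsupRatio_pos_iff (hγ : IsGlobalWeight γ) (hg : ∀ t, 0 ≤ g t) :
    0 < limsupRatio g γ ↔ ¬ g =o[atTop] γ := by
  rw [← limsupRatio_eq_zero_iff hγ hg, (limsupRatio_nonneg hγ hg).lt_iff_ne, ne_comm]

theorem limsupRatio_congr {g' γ' : ℝ → ℝ} (hg : g =ᶠ[atTop] g') (hγ : γ =ᶠ[atTop] γ') :
    limsupRatio g γ = limsupRatio g' γ' := by
  refine limsup_congr ?_
  filter_upwards [hg, hγ] with t h1 h2
  rw [h1, h2]

end LimsupRatio

/-! ### Equivalence of norms -/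

section Norms

open Asymptotics

variable {d : ℕ}

theorem Seminorm.exists_le_mul_norm (N : Seminorm ℝ (Fin d → ℝ)) :
    ∃ C > 0, ∀ v, N v ≤ C * ‖v‖ := by
  refine ⟨1 + ∑ i, N (Pi.single i 1),
    add_pos_of_pos_of_nonneg one_pos (Finset.sum_nonneg fun i _ => apply_nonneg N _), fun v => ?_⟩
  have h1 : N v ≤ ∑ i, N (v i • Pi.single i 1) := by
    conv_lhs => rw [pi_eq_sum_univ' v]
    exact Finset.le_sum_of_subadditive N (map_zero N).le (map_add_le_add N) _ _
  have h2 : ∑ i, N (v i • Pi.single i 1) ≤ ∑ i, N (Pi.single i 1) * ‖v‖ := by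
    refine Finset.sum_le_sum fun i _ => ?_
    rw [map_smul_eq_mul, mul_comm]
    exact mul_le_mul_of_nonneg_left (norm_le_pi_norm v i) (apply_nonneg N _)
  rw [← Finset.sum_mul] at h2
  linarith [norm_nonneg v]

theorem Seminorm.exists_mul_norm_le (N : Seminorm ℝ (Fin d → ℝ)) (hN : ∀ v, N v = 0 → v = 0) :
    ∃ c > 0, ∀ v, c * ‖v‖ ≤ N v := by
  obtain ⟨C, hC, hNC⟩ := N.exists_le_mul_norm
  have hcont : Continuous N := by
    refine (LipschitzWith.of_dist_le_mul (K := ⟨C, hC.le⟩) fun u v => ?_).continuous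
    rw [Real.dist_eq, dist_eq_norm]
    exact (abs_sub_map_le_sub N u v).trans (hNC _)
  rcases (Metric.sphere (0 : Fin d → ℝ) 1).eq_empty_or_nonempty with he | hne
  -- The unit sphere is empty only for d = 0.
  · refine ⟨1, one_pos, fun v => ?_⟩
    rcases eq_or_ne v 0 with rfl | hv
    · simp
    · have : ‖v‖⁻¹ • v ∈ Metric.sphere (0 : Fin d → ℝ) 1 := by
        simp [norm_smul, hv]
      rw [he] at this
      exact this.elim
  · obtain ⟨u, hu, hmin⟩ := (isCompact_sphere (0 : Fin d → ℝ) 1).exists_isMinOn hne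
      hcont.continuousOn
    refine ⟨N u, lt_of_le_of_ne (apply_nonneg N u) fun h => ?_, fun v => ?_⟩
    · rw [hN u h.symm] at hu
      simp at hu
    · rcases eq_or_ne v 0 with rfl | hv
      · simp
      · have hv' := norm_pos_iff.2 hv
        have h1 : ‖v‖⁻¹ • v ∈ Metric.sphere (0 : Fin d → ℝ) 1 := by
          simp [norm_smul, hv]
        have h2 : N u ≤ N (‖v‖⁻¹ • v) := hmin h1
        rw [map_smul_eq_mul, norm_inv, norm_norm, inv_mul_eq_div, le_div_iff₀ hv'] at h2
        exact h2

theorem Seminorm.isTheta_norm (N : Seminorm ℝ (Fin d → ℝ)) (hN : ∀ v, N v = 0 → v = 0)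
    (l : Filter ℝ) (f : ℝ → Fin d → ℝ) : (fun t => N (f t)) =Θ[l] f := by
  obtain ⟨C, -, hNC⟩ := N.exists_le_mul_norm
  obtain ⟨c, hc, hcN⟩ := N.exists_mul_norm_le hN
  constructor
  · refine IsBigO.of_bound C (Eventually.of_forall fun t => ?_)
    rw [Real.norm_of_nonneg (apply_nonneg N _)]
    exact hNC _
  · refine IsBigO.of_bound c⁻¹ (Eventually.of_forall fun t => ?_)
    rw [Real.norm_of_nonneg (apply_nonneg N _), ← div_eq_inv_mul, le_div_iff₀ hc, mul_comm]
    exact hcN _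

theorem limsupRatio_norm_mem_Ioo_iff {γ : ℝ → ℝ} (hγ : IsGlobalWeight γ)
    (N : Seminorm ℝ (Fin d → ℝ)) (hN : ∀ v, N v = 0 → v = 0) (f : ℝ → Fin d → ℝ) :
    limsupRatio (fun t => N (f t)) γ ∈ Ioo (0 : EReal) ⊤ ↔
      f =O[atTop] γ ∧ ¬ f =o[atTop] γ := by
  rw [mem_Ioo, limsupRatio_pos_iff hγ fun t => apply_nonneg N _,
    limsupRatio_lt_top_iff hγ fun t => apply_nonneg N _,
    (N.isTheta_norm hN atTop f).isBigO_congr_left,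
    (N.isTheta_norm hN atTop f).isLittleO_congr_left, and_comm]

end Norms

/-! ### Comparison of solutions with the same forcing -/

section Solutions

open Asymptotics

variable {d : ℕ} {A B : Matrix (Fin d) (Fin d) ℝ} {F x y : ℝ → Fin d → ℝ} {ζ ξ : Fin d → ℝ}
  {γ : ℝ → ℝ}

theorem IsLinearODESolution.hasDerivAt (hx : IsLinearODESolution A F ζ x) :
    ∀ᶠ t in atTop, HasDerivAt x (A.mulVec (x t) + F t) t := by
  filter_upwards [eventually_gt_atTop 0] with t ht
  exact (hx.hasDeriv t ht.le).hasDerivAt (Ici_mem_nhds ht)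

theorem IsLinearODESolution.hasDerivAt_sub (hx : IsLinearODESolution A F ζ x)
    (hy : IsLinearODESolution B F ξ y) :
    ∀ᶠ t in atTop, HasDerivAt (fun t => x t - y t)
      (A.mulVec (x t - y t) + (A - B).mulVec (y t)) t := by
  filter_upwards [hx.hasDerivAt, hy.hasDerivAt] with t h1 h2
  refine (h1.sub h2).congr_deriv ?_
  rw [Matrix.mulVec_sub, Matrix.sub_mulVec]
  abel

theorem Matrix.mulVec_isBigO (A : Matrix (Fin d) (Fin d) ℝ) (f : ℝ → Fin d → ℝ) (l : Filter ℝ) :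
    (fun t => A.mulVec (f t)) =O[l] f :=
  (LinearMap.toContinuousLinearMap A.mulVecLin).isBigO_comp f l

theorem IsLinearODESolution.isBigO_of_isBigO (hx : IsLinearODESolution A F ζ x)
    (hy : IsLinearODESolution B F ξ y) (hA : IsHurwitz A) (hγ : IsGlobalWeight γ)
    (h : y =O[atTop] γ) : x =O[atTop] γ := by
  simpa using (hA.isBigO hγ (hx.hasDerivAt_sub hy) ((Matrix.mulVec_isBigO _ y _).trans h)).add h

theorem IsLinearODESolution.isLittleO_of_isLittleO (hx : IsLinearODESolution A F ζ x)
    (hy : IsLinearODESolution B F ξ y) (hA : IsHurwitz A) (hγ : IsGlobalWeight γ)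
    (h : y =o[atTop] γ) : x =o[atTop] γ := by
  simpa using
    (hA.isLittleO hγ (hx.hasDerivAt_sub hy) ((Matrix.mulVec_isBigO _ y _).trans_isLittleO h)).add h

end Solutions

/-! ### Window integrals as increments of a primitive -/

section Windows

open Asymptotics

variable {d : ℕ} {F : ℝ → Fin d → ℝ} {γ : ℝ → ℝ}

theorem hasDerivAt_integral_of_continuous (hF : Continuous F) (t : ℝ) :
    HasDerivAt (fun u => ∫ s in (0 : ℝ)..u, F s) (F t) t :=
  intervalIntegral.integral_hasDerivAt_right (hF.intervalIntegrable _ _)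
    hF.aestronglyMeasurable.stronglyMeasurableAtFilter hF.continuousAt

theorem integral_window_eq (hF : Continuous F) (a b : ℝ) :
    ∫ s in a..b, F s = (∫ s in (0 : ℝ)..b, F s) - ∫ s in (0 : ℝ)..a, F s :=
  (intervalIntegral.integral_interval_sub_left (hF.intervalIntegrable _ _)
    (hF.intervalIntegrable _ _)).symm

theorem integral_apply_of_continuous (hF : Continuous F) (i : Fin d) (a b : ℝ) :
    ∫ s in a..b, F s i = (∫ s in a..b, F s) i :=
  (ContinuousLinearMap.proj (R := ℝ) (φ := fun _ : Fin d => ℝ) i).intervalIntegral_comp_comm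
    (hF.intervalIntegrable a b)

theorem windowLimsup_eq_zero_iff (hγ : IsGlobalWeight γ) (hF : Continuous F) (i : Fin d) (θ : ℝ) :
    windowLimsup F γ i θ = 0 ↔
      θ ∈ negligibleLags hγ (fun t => (∫ s in (0 : ℝ)..t, F s) i) := by
  rw [windowLimsup, limsupRatio_eq_zero_iff hγ (fun _ => abs_nonneg _), mem_negligibleLags,
    isLittleO_abs_left]
  simp only [integral_apply_of_continuous hF, integral_window_eq hF (_ - _), Pi.sub_apply]

theorem windowLimsup_pos_iff (hγ : IsGlobalWeight γ) (i : Fin d) (θ : ℝ) :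
    0 < windowLimsup F γ i θ ↔ windowLimsup F γ i θ ≠ 0 := by
  have h : 0 ≤ windowLimsup F γ i θ := limsupRatio_nonneg hγ fun _ => abs_nonneg _
  rw [h.lt_iff_ne, ne_comm]

theorem WindowBound.eventually_norm_le {N : Seminorm ℝ (Fin d → ℝ)} {Δ K : ℝ}
    (hF : Continuous F) (hN : ∀ v, N v = 0 → v = 0) (h : WindowBound N F γ Δ K) :
    ∃ K' : ℝ, ∀ᶠ t in atTop, ∀ θ ∈ Icc 0 Δ,
      ‖(∫ s in (0 : ℝ)..t, F s) - ∫ s in (0 : ℝ)..(t - θ), F s‖ ≤ K' * γ t := by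
  obtain ⟨c, hc, hcN⟩ := N.exists_mul_norm_le hN
  refine ⟨K / c, ?_⟩
  filter_upwards [eventually_ge_atTop 0, eventually_ge_atTop Δ] with t h0 h1 θ hθ
  have h2 := h θ hθ t h0
  rw [max_eq_left (by linarith [hθ.2]), integral_window_eq hF] at h2
  rw [div_mul_eq_mul_div, le_div_iff₀ hc, mul_comm]
  exact (hcN _).trans h2

theorem exists_windowBound_of_isBigO (hγ : IsGlobalWeight γ) (hF : Continuous F)
    (N : Seminorm ℝ (Fin d → ℝ)) {y : ℝ → Fin d → ℝ}
    (hy : ∀ᶠ t in atTop, HasDerivAt y (-y t + F t) t) (hO : y =O[atTop] γ) (Δ : ℝ) :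
    ∃ K > 0, WindowBound N F γ Δ K := by
  obtain ⟨C, hC, hNC⟩ := N.exists_le_mul_norm
  set G : ℝ → Fin d → ℝ := fun t => ∫ s in (0 : ℝ)..t, F s
  have hG : ∀ t, HasDerivAt G (F t) t := hasDerivAt_integral_of_continuous hF
  have hGc : Continuous G := continuous_iff_continuousAt.2 fun t => (hG t).continuousAt
  obtain ⟨M, hM, hgain⟩ := hγ.exists_window_gain hG hy Δ
  obtain ⟨b, hb, hyb⟩ := hO.exists_pos
  obtain ⟨T, hT⟩ := eventually_atTop.1 (hgain b hb (by
    filter_upwards [hyb.bound] with t ht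
    simpa [abs_of_pos (hγ.pos t)] using ht))
  -- The asymptotic bound says nothing for small t; there compactness in (θ, t) does. Beyond `max T
  -- Δ` the truncation at 0 is inactive.
  obtain ⟨B, hB⟩ := ((isCompact_Icc (a := (0 : ℝ)) (b := Δ)).prod
    (isCompact_Icc (a := (0 : ℝ)) (b := max T Δ))).bddAbove_image
    (f := fun p : ℝ × ℝ => ‖G p.2 - G (max (p.2 - p.1) 0)‖ / γ p.2)
    (Continuous.continuousOn (Continuous.div (by fun_prop) (hγ.continuous.comp continuous_snd)
      fun p => (hγ.pos _).ne'))
  refine ⟨C * max (M * b) B, by have := le_max_left (M * b) B; positivity, fun θ hθ t ht => ?_⟩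
  rw [integral_window_eq hF, mul_assoc]
  refine (hNC _).trans (mul_le_mul_of_nonneg_left ?_ hC.le)
  rcases le_total t (max T Δ) with h1 | h1
  · have h2 : ‖G t - G (max (t - θ) 0)‖ / γ t ≤ B := hB ⟨(θ, t), ⟨hθ, ht, h1⟩, rfl⟩
    exact (div_le_iff₀ (hγ.pos t)).1 (h2.trans (le_max_right _ _))
  · have h2 := hT t ((le_max_left _ _).trans h1) θ hθ
    rw [max_eq_left (by linarith [hθ.2, (le_max_right T Δ).trans h1])]
    exact h2.trans (mul_le_mul_of_nonneg_right (le_max_left _ _) (hγ.pos t).le)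

end Windows

/-! ### The equivalences -/

section Main

open Asymptotics

variable {d : ℕ} {F : ℝ → Fin d → ℝ} {γ : ℝ → ℝ}

/-- The equivalences for forcing terms and weights that are continuous on the whole line. -/
theorem tfae_of_isGlobalWeight (N : Seminorm ℝ (Fin d → ℝ)) (hN : ∀ v, N v = 0 → v = 0)
    (A : Matrix (Fin d) (Fin d) ℝ) (hA : IsHurwitz A) (hF : Continuous F) (ζ : Fin d → ℝ)
    (x y : ℝ → Fin d → ℝ) (hx : IsLinearODESolution A F ζ x)
    (hy : IsLinearODESolution (-1) F 0 y) (hγ : IsGlobalWeight γ) :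
    List.TFAE [
      (∃ Δ > 0, ∃ K > 0, WindowBound N F γ Δ K) ∧
        (∃ i : Fin d, ∃ θ' > 0, 0 < windowLimsup F γ i θ'),
      ∀ Δ > 0, (∃ K > 0, WindowBound N F γ Δ K) ∧
        (∃ i : Fin d, ∃ θ' ∈ Ioc 0 Δ, 0 < windowLimsup F γ i θ'),
      ∀ Δ > 0, (∃ K > 0, WindowBound N F γ Δ K) ∧
        (∃ i : Fin d, volume {θ : ℝ | θ ∈ Icc 0 Δ ∧ windowLimsup F γ i θ = 0} = 0),
      limsupRatio (fun t => N (y t)) γ ∈ Ioo (0 : EReal) ⊤,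
      limsupRatio (fun t => N (x t)) γ ∈ Ioo (0 : EReal) ⊤] := by
  set G : ℝ → Fin d → ℝ := fun t => ∫ s in (0 : ℝ)..t, F s with hGdef
  have hG : ∀ t, HasDerivAt G (F t) t := hasDerivAt_integral_of_continuous hF
  have hGc : Continuous G := continuous_iff_continuousAt.2 fun t => (hG t).continuousAt
  have hyd : ∀ᶠ t in atTop, HasDerivAt y (-y t + F t) t := by
    simpa [Matrix.neg_mulVec] using hy.hasDerivAt
  rw [limsupRatio_norm_mem_Ioo_iff hγ N hN, limsupRatio_norm_mem_Ioo_iff hγ N hN]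
  tfae_have 1 → 4 := by
    rintro ⟨⟨Δ, hΔ, K, -, hK⟩, i, θ, hθ, hpos⟩
    obtain ⟨K', hK'⟩ := hK.eventually_norm_le hF hN
    refine ⟨isBigO_of_window_bound hγ hG hyd hΔ hK', fun ho => hpos.ne' ?_⟩
    rw [windowLimsup_eq_zero_iff hγ hF, mem_negligibleLags]
    exact isLittleO_pi.1 (hγ.window_isLittleO hG hyd ho hθ.le) i
  tfae_have 4 → 3 := by
    rintro ⟨hO, ho⟩ Δ hΔ
    obtain ⟨K, hK, hW⟩ := exists_windowBound_of_isBigO hγ hF N hyd hO Δ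
    refine ⟨⟨K, hK, hW⟩, ?_⟩
    -- Otherwise every component has a non-null set of negligible lags, hence all lags are
    -- negligible and y = o(γ).
    by_contra! hne
    obtain ⟨K', hK'⟩ := hW.eventually_norm_le hF hN
    refine ho (isLittleO_of_window_isLittleO hγ hG hyd hΔ hK' fun θ _ => isLittleO_pi.2 fun i => ?_)
    have htop := negligibleLags_eq_top_of_volume_pos hγ (G := fun t => G t i) (by fun_prop)
      (lt_of_lt_of_le (pos_iff_ne_zero.2 (hne i)) (measure_mono fun θ hθ =>
        (windowLimsup_eq_zero_iff hγ hF i θ).1 hθ.2))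
    exact mem_negligibleLags.1 (htop ▸ AddSubgroup.mem_top θ)
  tfae_have 3 → 2 := by
    intro h Δ hΔ
    obtain ⟨hK, i, hi⟩ := h Δ hΔ
    refine ⟨hK, i, ?_⟩
    by_contra! hne
    have hsub : Ioc 0 Δ ⊆ {θ : ℝ | θ ∈ Icc 0 Δ ∧ windowLimsup F γ i θ = 0} := fun θ hθ =>
      ⟨Ioc_subset_Icc_self hθ, by
        by_contra h0
        exact (hne θ hθ).not_gt ((windowLimsup_pos_iff hγ i θ).2 h0)⟩
    have h0 := measure_mono_null hsub hi
    rw [Real.volume_Ioc, ENNReal.ofReal_eq_zero] at h0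
    linarith
  tfae_have 2 → 1 := by
    intro h
    obtain ⟨hK, i, θ, hθ, hpos⟩ := h 1 one_pos
    exact ⟨⟨1, one_pos, hK⟩, i, θ, hθ.1, hpos⟩
  tfae_have 4 → 5 := fun ⟨hO, ho⟩ =>
    ⟨hx.isBigO_of_isBigO hy hA hγ hO,
      fun h => ho (hy.isLittleO_of_isLittleO hx isHurwitz_neg_one hγ h)⟩
  tfae_have 5 → 4 := fun ⟨hO, ho⟩ =>
    ⟨hy.isBigO_of_isBigO hx isHurwitz_neg_one hγ hO,
      fun h => ho (hx.isLittleO_of_isLittleO hy hA hγ h)⟩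
  tfae_finish

/-! ### Reduction to data frozen at their time-0 values for negative times -/

theorem IsLinearODESolution.extend_forcing {A : Matrix (Fin d) (Fin d) ℝ} {ζ : Fin d → ℝ}
    {x : ℝ → Fin d → ℝ} (hx : IsLinearODESolution A F ζ x) :
    IsLinearODESolution A (fun t => F (max t 0)) ζ x where
  initial := hx.initial
  hasDeriv t ht := by simpa only [max_eq_left ht] using hx.hasDeriv t ht

theorem integral_extend_forcing {E : Type*} [NormedAddCommGroup E] [NormedSpace ℝ E] (f : ℝ → E)
    {a b : ℝ} (ha : 0 ≤ a) (hab : a ≤ b) :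
    ∫ s in a..b, f (max s 0) = ∫ s in a..b, f s := by
  refine intervalIntegral.integral_congr fun s hs => ?_
  rw [uIcc_of_le hab] at hs
  simp only [max_eq_left (ha.trans hs.1)]

theorem windowBound_extend_forcing (N : Seminorm ℝ (Fin d → ℝ)) {Δ K : ℝ} :
    WindowBound N (fun t => F (max t 0)) (fun t => γ (max t 0)) Δ K ↔ WindowBound N F γ Δ K := by
  refine forall₂_congr fun θ hθ => forall₂_congr fun t ht => ?_
  rw [integral_extend_forcing F (le_max_right _ _) (max_le (by linarith [hθ.1]) ht)]
  simp only [max_eq_left ht]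

theorem eventuallyEq_extend (γ : ℝ → ℝ) : (fun t => γ (max t 0)) =ᶠ[atTop] γ := by
  filter_upwards [eventually_ge_atTop 0] with t ht
  rw [max_eq_left ht]

theorem windowLimsup_extend_forcing (i : Fin d) {θ : ℝ} (hθ : 0 ≤ θ) :
    windowLimsup (fun t => F (max t 0)) (fun t => γ (max t 0)) i θ = windowLimsup F γ i θ := by
  refine limsupRatio_congr ?_ (eventuallyEq_extend γ)
  filter_upwards [eventually_ge_atTop θ] with t ht
  rw [integral_extend_forcing (fun s => F s i) (by linarith) (by linarith)]

end Main

/-- Here `N` is an arbitrary norm on `ℝ^d`: a seminorm that vanishes only at `0`. -/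
theorem mainTheorem9 {d : ℕ} (N : Seminorm ℝ (Fin d → ℝ)) (hN : ∀ v, N v = 0 → v = 0)
    (A : Matrix (Fin d) (Fin d) ℝ) (hA : IsHurwitz A)
    (F : ℝ → Fin d → ℝ) (hF : ContinuousOn F (Ici 0))
    (ζ : Fin d → ℝ)
    (x : ℝ → Fin d → ℝ) (hx : IsLinearODESolution A F ζ x)
    (y : ℝ → Fin d → ℝ) (hy : IsLinearODESolution (-1) F 0 y)
    (γ : ℝ → ℝ) (hγ : IsSubexponential γ) :
    List.TFAE [
      (∃ Δ > 0, ∃ K > 0, WindowBound N F γ Δ K) ∧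
        (∃ i : Fin d, ∃ θ' > 0, 0 < windowLimsup F γ i θ'),
      ∀ Δ > 0, (∃ K > 0, WindowBound N F γ Δ K) ∧
        (∃ i : Fin d, ∃ θ' ∈ Ioc 0 Δ, 0 < windowLimsup F γ i θ'),
      ∀ Δ > 0, (∃ K > 0, WindowBound N F γ Δ K) ∧
        (∃ i : Fin d, volume {θ : ℝ | θ ∈ Icc 0 Δ ∧ windowLimsup F γ i θ = 0} = 0),
      limsupRatio (fun t => N (y t)) γ ∈ Ioo (0 : EReal) ⊤,
      limsupRatio (fun t => N (x t)) γ ∈ Ioo (0 : EReal) ⊤] := by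
  have hFc : Continuous fun t => F (max t 0) :=
    hF.comp_continuous (by fun_prop) fun t => mem_Ici.2 (le_max_right t 0)
  have h := tfae_of_isGlobalWeight N hN A hA hFc ζ x y
    hx.extend_forcing hy.extend_forcing hγ.isGlobalWeight
  have h1 : ∀ i, (∃ θ' > 0, 0 < windowLimsup (fun t => F (max t 0)) (fun t => γ (max t 0)) i θ') ↔
      ∃ θ' > 0, 0 < windowLimsup F γ i θ' := fun i => exists_congr fun θ =>
    and_congr_right fun hθ => by rw [windowLimsup_extend_forcing i (le_of_lt hθ)]
  have h2 : ∀ i Δ, (∃ θ' ∈ Ioc 0 Δ,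
      0 < windowLimsup (fun t => F (max t 0)) (fun t => γ (max t 0)) i θ') ↔
      ∃ θ' ∈ Ioc 0 Δ, 0 < windowLimsup F γ i θ' := fun i Δ => exists_congr fun θ =>
    and_congr_right fun hθ => by rw [windowLimsup_extend_forcing i hθ.1.le]
  have h3 : ∀ i Δ, {θ : ℝ | θ ∈ Icc 0 Δ ∧
      windowLimsup (fun t => F (max t 0)) (fun t => γ (max t 0)) i θ = 0} =
      {θ : ℝ | θ ∈ Icc 0 Δ ∧ windowLimsup F γ i θ = 0} := fun i Δ => Set.ext fun θ =>
    and_congr_right fun hθ => by rw [windowLimsup_extend_forcing i hθ.1]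
  have h4 : ∀ g : ℝ → ℝ, limsupRatio g (fun t => γ (max t 0)) = limsupRatio g γ := fun g =>
    limsupRatio_congr EventuallyEq.rfl (eventuallyEq_extend γ)
  simpa only [windowBound_extend_forcing, h1, h2, h3, h4] using h
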